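/- Let $n\in\mathbb{N}$, let $\Omega\subsetneq\mathbb{R}^n$ be any open set (not necessarily connected or bounded), and put $\delta(x)=\operatorname{dist}(x,\mathbb{R}^n\setminus\Omega)$. Let $0<s<1$ and $p>1$ be real numbers with $sp>n$. Then there is a constant $C>0$, independent of $u$, such that $$\int_{\Omega}\frac{|u(x)|^p}{\delta(x)^{sp}}\,dx\le C\int_{\mathbb{R}^n}\int_{\mathbb{R}^n}\frac{|u(x)-u(y)|^p}{|x-y|^{n+sp}}\,dx\,dy\qquad\text{for all real-valued }u\in C_c^\infty(\Omega).$$ Furthermore, there is a constant $C>0$, independent of $u$, such that $$\int_{\Omega}\frac{|u(x)|^p}{\delta(x)^{sp}}\,dx\le C\int_{\Omega}\int_{\Omega}\frac{|u(x)-u(y)|^p}{|x-y|^{n+sp}}\,dx\,dy\qquad\text{for all real-valued }u\in C_c^\infty(\Omega).$$ Here $u\in C_c^\infty(\Omega)$ is extended by zero to $\mathbb{R}^n$. -/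

import Mathlib

open MeasureTheory
open scoped ENNReal ContDiff

noncomputable section

/-- The `p`-th power of the Gagliardo seminorm of `u` on `Ω`, as a value in `[0, ∞]`:
`∫_Ω ∫_Ω |u x - u y| ^ p / |x - y| ^ (n + s p) dx dy`. -/
def gagliardoSeminormPow {n : ℕ} (s p : ℝ) (Ω : Set (EuclideanSpace ℝ (Fin n)))
    (u : EuclideanSpace ℝ (Fin n) → ℝ) : ℝ≥0∞ :=
  ∫⁻ y in Ω, ∫⁻ x in Ω,
    ENNReal.ofReal (|u x - u y| ^ p / ‖x - y‖ ^ ((n : ℝ) + s * p))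

/-- The Hardy integral `∫_Ω |u x| ^ p / δ x ^ (s p) dx`, as a value in `[0, ∞]`, where
`δ x = dist (x, Ωᶜ)`. -/
def hardyIntegral {n : ℕ} (s p : ℝ) (Ω : Set (EuclideanSpace ℝ (Fin n)))
    (u : EuclideanSpace ℝ (Fin n) → ℝ) : ℝ≥0∞ :=
  ∫⁻ x in Ω, ENNReal.ofReal (|u x| ^ p / Metric.infDist x Ωᶜ ^ (s * p))

/-- `u ∈ C_c^∞(Ω)`: `u` (extended by zero) is smooth with compact support contained in `Ω`. -/
def IsTestFunctionOn {n : ℕ} (Ω : Set (EuclideanSpace ℝ (Fin n)))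
    (u : EuclideanSpace ℝ (Fin n) → ℝ) : Prop :=
  ContDiff ℝ ∞ u ∧ HasCompactSupport u ∧ tsupport u ⊆ Ω

end

open Metric MeasureTheory
open scoped ENNReal ContDiff

/-! Write δ for the distance to the complement, H for the Hardy integral, G for the Gagliardo energy
on Ω. Each x in Ω is compared with the points y of a ball of radius (l/2)δ(x), lying at depth about
l·δ(x) between x and its nearest boundary point (`exists_ball_near_compl`). Averaging the two-point
bound `hardyDensity_le_of_near` over y and integrating in x gives, by Tonelli, l^n H ≤ C(G + l^(sp)
l^n · l^(-n) H) with C independent of l (`hardyIntegral_le_gagliardo_add`). As sp > n, a small l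
makes the last term at most half of the left side; it is absorbed because H is finite for test
functions. -/

/-- The integrand of `hardyIntegral`. -/
noncomputable def hardyDensity {n : ℕ} (s p : ℝ) (Ω : Set (EuclideanSpace ℝ (Fin n)))
    (u : EuclideanSpace ℝ (Fin n) → ℝ) (x : EuclideanSpace ℝ (Fin n)) : ℝ :=
  |u x| ^ p / infDist x Ωᶜ ^ (s * p)

lemma hardyDensity_nonneg {n : ℕ} (s p : ℝ) (Ω : Set (EuclideanSpace ℝ (Fin n)))
    (u : EuclideanSpace ℝ (Fin n) → ℝ) (x : EuclideanSpace ℝ (Fin n)) :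
    0 ≤ hardyDensity s p Ω u x :=
  div_nonneg (Real.rpow_nonneg (abs_nonneg _) _) (Real.rpow_nonneg infDist_nonneg _)

lemma measurable_hardyDensity {n : ℕ} (s p : ℝ) (Ω : Set (EuclideanSpace ℝ (Fin n)))
    {u : EuclideanSpace ℝ (Fin n) → ℝ} (hu : Measurable u) :
    Measurable (hardyDensity s p Ω u) := by
  have hδ : Measurable fun x => infDist x Ωᶜ := measurable_infDist
  exact (((measurable_norm.comp hu)).pow_const p).div (hδ.pow_const (s * p))

lemma infDist_compl_pos {X : Type*} [PseudoMetricSpace X] {Ω : Set X} (hΩ : IsOpen Ω)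
    (hne : Ω ≠ Set.univ) {x : X} (hx : x ∈ Ω) : 0 < infDist x Ωᶜ :=
  (hΩ.isClosed_compl.notMem_iff_infDist_pos (Set.nonempty_compl.2 hne)).1 (by simpa using hx)

/-- A Whitney-type ball shifted towards the boundary: at scale `l` it is comparable in size and in
distance to the complement with `l * infDist x Ωᶜ`. -/
lemma exists_ball_near_compl {E : Type*} [NormedAddCommGroup E] [NormedSpace ℝ E] [ProperSpace E]
    {Ω : Set E} (hΩ : IsOpen Ω) (hne : Ω ≠ Set.univ) {l : ℝ} (hl0 : 0 < l) (hl1 : l ≤ 1)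
    {x : E} (hx : x ∈ Ω) :
    ∃ c, ∀ y ∈ ball c (l / 2 * infDist x Ωᶜ), y ∈ Ω ∧ infDist y Ωᶜ ≤ 3 / 2 * l * infDist x Ωᶜ ∧
      infDist x Ωᶜ ≤ 2 / l * infDist y Ωᶜ ∧ dist x y ≤ infDist x Ωᶜ := by
  obtain ⟨z, hz, hxz⟩ :=
    hΩ.isClosed_compl.exists_infDist_eq_dist (Set.nonempty_compl.2 hne) x
  have hr := infDist_compl_pos hΩ hne hx
  set r := infDist x Ωᶜ with hr_def
  refine ⟨z + l • (x - z), fun y hy => ?_⟩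
  rw [mem_ball] at hy
  have hcz : dist (z + l • (x - z)) z = l * r := by
    rw [dist_eq_norm, add_sub_cancel_left, norm_smul, Real.norm_of_nonneg hl0.le, hxz,
      dist_eq_norm]
  have hxc : dist x (z + l • (x - z)) = (1 - l) * r := by
    have : x - (z + l • (x - z)) = (1 - l) • (x - z) := by module
    rw [dist_eq_norm, this, norm_smul, Real.norm_of_nonneg (by linarith), hxz, dist_eq_norm]
  have hxy : dist x y ≤ (1 - l / 2) * r := by
    have := dist_triangle_right x y (z + l • (x - z))
    linarith
  have hyz : infDist y Ωᶜ ≤ 3 / 2 * l * r := by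
    have := dist_triangle y (z + l • (x - z)) z
    have := infDist_le_dist_of_mem (x := y) hz
    linarith
  -- The distance to the complement is 1-Lipschitz and `hxy` leaves a margin of l/2 * r; this also
  -- forces y into Ω.
  have hry : l / 2 * r ≤ infDist y Ωᶜ := by
    have := infDist_le_infDist_add_dist (s := Ωᶜ) (x := x) (y := y)
    linarith
  refine ⟨?_, hyz, ?_, by nlinarith⟩
  · by_contra hyΩ
    have := infDist_zero_of_mem (s := Ωᶜ) hyΩ
    have := mul_pos (half_pos hl0) hr
    linarith
  · calc r = 2 / l * (l / 2 * r) := by field_simp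
      _ ≤ _ := by gcongr

lemma abs_rpow_le_two_rpow_mul {p : ℝ} (hp : 1 ≤ p) (a b : ℝ) :
    |a| ^ p ≤ 2 ^ (p - 1) * (|a - b| ^ p + |b| ^ p) := by
  have h : |a| ≤ |a - b| + |b| := by simpa using abs_add_le (a - b) b
  exact (Real.rpow_le_rpow (abs_nonneg _) h (by linarith)).trans
    (mod_cast NNReal.rpow_add_le_mul_rpow_add_rpow ⟨|a - b|, abs_nonneg _⟩ ⟨|b|, abs_nonneg _⟩ hp)

/-- The two-point estimate behind the Hardy inequality: the Hardy density at `x` is controlled by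
the Gagliardo kernel and by the Hardy density at a point `y` much closer to the complement. -/
lemma hardyDensity_le_of_near {n : ℕ} {s p : ℝ} (hs : 0 < s) (hp : 1 < p)
    {Ω : Set (EuclideanSpace ℝ (Fin n))} (u : EuclideanSpace ℝ (Fin n) → ℝ) {L : ℝ} (hL : 0 < L)
    {x y : EuclideanSpace ℝ (Fin n)} (hδx : 0 < infDist x Ωᶜ) (hδy : 0 < infDist y Ωᶜ)
    (hyx : infDist y Ωᶜ ≤ L * infDist x Ωᶜ) (hxy : dist x y ≤ infDist x Ωᶜ) :
    hardyDensity s p Ω u x / infDist x Ωᶜ ^ n ≤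
      2 ^ (p - 1) * (|u x - u y| ^ p / ‖x - y‖ ^ (n + s * p) +
        L ^ (n + s * p) * (hardyDensity s p Ω u y / infDist y Ωᶜ ^ n)) := by
  have hq : 0 < n + s * p := by positivity
  have hdiv : ∀ w, 0 < infDist w Ωᶜ → hardyDensity s p Ω u w / infDist w Ωᶜ ^ n =
      |u w| ^ p / infDist w Ωᶜ ^ (n + s * p) := fun w hw => by
    rw [hardyDensity, div_div, Real.rpow_add hw, Real.rpow_natCast, mul_comm]
  rw [hdiv x hδx, hdiv y hδy]
  set a := infDist x Ωᶜ
  set b := infDist y Ωᶜ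
  have h1 : |u x - u y| ^ p / a ^ (n + s * p) ≤ |u x - u y| ^ p / ‖x - y‖ ^ (n + s * p) := by
    -- On the diagonal both numerators vanish, since p ≠ 0.
    rcases eq_or_ne x y with rfl | hne
    · simp [Real.zero_rpow (by linarith : p ≠ 0)]
    · have : 0 < ‖x - y‖ := norm_pos_iff.2 (sub_ne_zero.2 hne)
      rw [dist_eq_norm] at hxy
      gcongr
  have h2 : |u y| ^ p / a ^ (n + s * p) ≤
      L ^ (n + s * p) * (|u y| ^ p / b ^ (n + s * p)) := by
    have hb : b ^ (n + s * p) ≤ L ^ (n + s * p) * a ^ (n + s * p) := by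
      rw [← Real.mul_rpow hL.le hδx.le]
      exact Real.rpow_le_rpow hδy.le hyx hq.le
    rw [← mul_div_assoc, div_le_div_iff₀ (by positivity) (by positivity)]
    calc |u y| ^ p * b ^ (n + s * p) ≤ |u y| ^ p * (L ^ (n + s * p) * a ^ (n + s * p)) := by
          gcongr
      _ = _ := by ring
  calc |u x| ^ p / a ^ (n + s * p)
      ≤ 2 ^ (p - 1) * (|u x - u y| ^ p + |u y| ^ p) / a ^ (n + s * p) := by
        gcongr
        exact abs_rpow_le_two_rpow_mul hp.le _ _
    _ = 2 ^ (p - 1) * (|u x - u y| ^ p / a ^ (n + s * p) + |u y| ^ p / a ^ (n + s * p)) := by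
        ring
    _ ≤ _ := by gcongr

lemma volume_ball_scaled {n : ℕ} (c : EuclideanSpace ℝ (Fin n)) {k r : ℝ} (hk : 0 < k)
    (hr : 0 < r) :
    volume (ball c (k * r)) =
      ENNReal.ofReal (k ^ n) * ENNReal.ofReal (r ^ n) *
        volume (ball (0 : EuclideanSpace ℝ (Fin n)) 1) := by
  rw [Measure.addHaar_ball_of_pos _ _ (by positivity), finrank_euclideanSpace_fin, mul_pow,
    ENNReal.ofReal_mul (by positivity)]

/-- The Hardy density at `y` spread uniformly over a ball about `y` whose radius is `k` times the
distance of `y` to the complement. -/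
noncomputable def spreadDensity {n : ℕ} (s p k : ℝ) (Ω : Set (EuclideanSpace ℝ (Fin n)))
    (u : EuclideanSpace ℝ (Fin n) → ℝ) (x y : EuclideanSpace ℝ (Fin n)) : ℝ≥0∞ :=
  {q : EuclideanSpace ℝ (Fin n) × EuclideanSpace ℝ (Fin n) |
    dist q.1 q.2 ≤ k * infDist q.2 Ωᶜ}.indicator
    (fun q => ENNReal.ofReal (hardyDensity s p Ω u q.2 / infDist q.2 Ωᶜ ^ n)) (x, y)

lemma measurable_spreadDensity {n : ℕ} (s p k : ℝ) (Ω : Set (EuclideanSpace ℝ (Fin n)))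
    {u : EuclideanSpace ℝ (Fin n) → ℝ} (hu : Measurable u) :
    Measurable (Function.uncurry (spreadDensity s p k Ω u)) := by
  refine Measurable.indicator ?_ ?_
  · have h := measurable_hardyDensity s p Ω hu
    have hδ : Measurable fun x => infDist x Ωᶜ := measurable_infDist
    exact ((h.div (hδ.pow_const n)).ennreal_ofReal).comp measurable_snd
  · refine measurableSet_le ?_ ?_
    · exact measurable_dist
    · exact (measurable_infDist.comp measurable_snd).const_mul k

/-- After Tonelli, x ranges for fixed y over a ball of volume proportional to δ(y)^n, which cancels
the normalisation of the density. -/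
lemma lintegral_lintegral_spreadDensity_le {n : ℕ} {s p k : ℝ} (hk : 0 < k)
    {Ω : Set (EuclideanSpace ℝ (Fin n))} (hΩ : IsOpen Ω) (hne : Ω ≠ Set.univ)
    {u : EuclideanSpace ℝ (Fin n) → ℝ} (hu : Measurable u) :
    ∫⁻ x in Ω, ∫⁻ y in Ω, spreadDensity s p k Ω u x y ≤
      ENNReal.ofReal (k ^ n) * volume (ball (0 : EuclideanSpace ℝ (Fin n)) 1) *
        hardyIntegral s p Ω u := by
  rw [lintegral_lintegral_swap (measurable_spreadDensity s p k Ω hu).aemeasurable]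
  rw [hardyIntegral, ← lintegral_const_mul _ (by
    exact (measurable_hardyDensity s p Ω hu).ennreal_ofReal)]
  refine setLIntegral_mono' hΩ.measurableSet fun y hy => ?_
  have hδ := infDist_compl_pos hΩ hne hy
  calc ∫⁻ x in Ω, spreadDensity s p k Ω u x y
      ≤ ∫⁻ x, spreadDensity s p k Ω u x y := setLIntegral_le_lintegral _ _
    _ = ∫⁻ x, (closedBall y (k * infDist y Ωᶜ)).indicator
          (fun _ => ENNReal.ofReal (hardyDensity s p Ω u y / infDist y Ωᶜ ^ n)) x := rfl
    _ = ENNReal.ofReal (hardyDensity s p Ω u y / infDist y Ωᶜ ^ n) *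
          (ENNReal.ofReal (k ^ n) * ENNReal.ofReal (infDist y Ωᶜ ^ n) *
            volume (ball (0 : EuclideanSpace ℝ (Fin n)) 1)) := by
        rw [lintegral_indicator_const measurableSet_closedBall,
          Measure.addHaar_closedBall _ _ (by positivity), finrank_euclideanSpace_fin, mul_pow,
          ENNReal.ofReal_mul (by positivity)]
    _ = ENNReal.ofReal (k ^ n) * volume (ball (0 : EuclideanSpace ℝ (Fin n)) 1) *
          (ENNReal.ofReal (hardyDensity s p Ω u y / infDist y Ωᶜ ^ n) *
            ENNReal.ofReal (infDist y Ωᶜ ^ n)) := by ring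
    _ = _ := by
        rw [← ENNReal.ofReal_mul (div_nonneg (hardyDensity_nonneg _ _ _ _ _) (by positivity)),
          div_mul_cancel₀ _ (by positivity)]
        rfl

lemma hardyDensity_mul_volume_le {n : ℕ} {s p : ℝ} (hs : 0 < s) (hp : 1 < p)
    {Ω : Set (EuclideanSpace ℝ (Fin n))} (hΩ : IsOpen Ω) (hne : Ω ≠ Set.univ)
    {u : EuclideanSpace ℝ (Fin n) → ℝ} (hu : Measurable u) {l : ℝ} (hl0 : 0 < l) (hl1 : l ≤ 1)
    {x : EuclideanSpace ℝ (Fin n)} (hx : x ∈ Ω) :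
    ENNReal.ofReal ((l / 2) ^ n) * volume (ball (0 : EuclideanSpace ℝ (Fin n)) 1) *
        ENNReal.ofReal (hardyDensity s p Ω u x) ≤
      ENNReal.ofReal (2 ^ (p - 1)) *
        ((∫⁻ y in Ω, ENNReal.ofReal (|u y - u x| ^ p / ‖y - x‖ ^ (n + s * p))) +
          ENNReal.ofReal ((3 / 2 * l) ^ (n + s * p)) *
            ∫⁻ y in Ω, spreadDensity s p (2 / l) Ω u x y) := by
  obtain ⟨c, hc⟩ := exists_ball_near_compl hΩ hne hl0 hl1 hx
  have hδ := infDist_compl_pos hΩ hne hx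
  have hK : Measurable (spreadDensity s p (2 / l) Ω u x) :=
    (measurable_spreadDensity s p (2 / l) Ω hu).of_uncurry_left
  set r := infDist x Ωᶜ with hr
  calc ENNReal.ofReal ((l / 2) ^ n) * volume (ball (0 : EuclideanSpace ℝ (Fin n)) 1) *
        ENNReal.ofReal (hardyDensity s p Ω u x)
      = ENNReal.ofReal ((l / 2) ^ n) * volume (ball (0 : EuclideanSpace ℝ (Fin n)) 1) *
        (ENNReal.ofReal (hardyDensity s p Ω u x / r ^ n) * ENNReal.ofReal (r ^ n)) := by
        rw [← ENNReal.ofReal_mul (div_nonneg (hardyDensity_nonneg _ _ _ _ _) (by positivity)),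
          div_mul_cancel₀ _ (by positivity)]
    _ = ∫⁻ _ in ball c (l / 2 * r), ENNReal.ofReal (hardyDensity s p Ω u x / r ^ n) := by
        rw [setLIntegral_const, volume_ball_scaled c (half_pos hl0) hδ]
        ring
    _ ≤ ∫⁻ y in ball c (l / 2 * r), ENNReal.ofReal (2 ^ (p - 1)) *
          (ENNReal.ofReal (|u y - u x| ^ p / ‖y - x‖ ^ (n + s * p)) +
            ENNReal.ofReal ((3 / 2 * l) ^ (n + s * p)) * spreadDensity s p (2 / l) Ω u x y) := by
        refine setLIntegral_mono' measurableSet_ball fun y hy => ?_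
        obtain ⟨hyΩ, hyx, hxy, hd⟩ := hc y hy
        have hδy := infDist_compl_pos hΩ hne hyΩ
        -- The ball depends on a choice of nearest point to x. It is replaced by the condition |x -
        -- y| ≤ (2/l) δ(y), which is jointly measurable and confines x once y is fixed.
        have hmem : (x, y) ∈ {q : EuclideanSpace ℝ (Fin n) × EuclideanSpace ℝ (Fin n) |
            dist q.1 q.2 ≤ 2 / l * infDist q.2 Ωᶜ} := hd.trans hxy
        rw [spreadDensity, Set.indicator_of_mem hmem, ← ENNReal.ofReal_mul (by positivity),
          ← ENNReal.ofReal_add (by positivity) (mul_nonneg (by positivity)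
            (div_nonneg (hardyDensity_nonneg _ _ _ _ _) (by positivity))),
          ← ENNReal.ofReal_mul (by positivity), abs_sub_comm (u y), norm_sub_rev y]
        exact ENNReal.ofReal_le_ofReal
          (hardyDensity_le_of_near hs hp u (by positivity) hδ hδy hyx hd)
    _ ≤ ∫⁻ y in Ω, ENNReal.ofReal (2 ^ (p - 1)) *
          (ENNReal.ofReal (|u y - u x| ^ p / ‖y - x‖ ^ (n + s * p)) +
            ENNReal.ofReal ((3 / 2 * l) ^ (n + s * p)) * spreadDensity s p (2 / l) Ω u x y) :=
        lintegral_mono_set fun y hy => (hc y hy).1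
    _ = _ := by
        rw [lintegral_const_mul' _ _ ENNReal.ofReal_ne_top,
          lintegral_add_right _ (hK.const_mul _),
          lintegral_const_mul' _ _ ENNReal.ofReal_ne_top]

lemma hardyIntegral_le_gagliardo_add {n : ℕ} {s p : ℝ} (hs : 0 < s) (hp : 1 < p)
    {Ω : Set (EuclideanSpace ℝ (Fin n))} (hΩ : IsOpen Ω) (hne : Ω ≠ Set.univ)
    {u : EuclideanSpace ℝ (Fin n) → ℝ} (hu : Measurable u) {l : ℝ} (hl0 : 0 < l) (hl1 : l ≤ 1) :
    ENNReal.ofReal ((l / 2) ^ n) * volume (ball (0 : EuclideanSpace ℝ (Fin n)) 1) *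
        hardyIntegral s p Ω u ≤
      ENNReal.ofReal (2 ^ (p - 1)) * (gagliardoSeminormPow s p Ω u +
        ENNReal.ofReal ((3 / 2 * l) ^ (n + s * p)) * (ENNReal.ofReal ((2 / l) ^ n) *
          volume (ball (0 : EuclideanSpace ℝ (Fin n)) 1) * hardyIntegral s p Ω u)) := by
  have hK : Measurable fun x => ∫⁻ y in Ω, spreadDensity s p (2 / l) Ω u x y :=
    (measurable_spreadDensity s p (2 / l) Ω hu).lintegral_prod_right'
  calc ENNReal.ofReal ((l / 2) ^ n) * volume (ball (0 : EuclideanSpace ℝ (Fin n)) 1) *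
        hardyIntegral s p Ω u
      = ∫⁻ x in Ω, ENNReal.ofReal ((l / 2) ^ n) *
          volume (ball (0 : EuclideanSpace ℝ (Fin n)) 1) *
          ENNReal.ofReal (hardyDensity s p Ω u x) :=
        (lintegral_const_mul _ (measurable_hardyDensity s p Ω hu).ennreal_ofReal).symm
    _ ≤ ∫⁻ x in Ω, ENNReal.ofReal (2 ^ (p - 1)) *
        ((∫⁻ y in Ω, ENNReal.ofReal (|u y - u x| ^ p / ‖y - x‖ ^ (n + s * p))) +
          ENNReal.ofReal ((3 / 2 * l) ^ (n + s * p)) *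
            ∫⁻ y in Ω, spreadDensity s p (2 / l) Ω u x y) :=
        setLIntegral_mono' hΩ.measurableSet fun x hx =>
          hardyDensity_mul_volume_le hs hp hΩ hne hu hl0 hl1 hx
    _ = ENNReal.ofReal (2 ^ (p - 1)) * (gagliardoSeminormPow s p Ω u +
        ENNReal.ofReal ((3 / 2 * l) ^ (n + s * p)) *
          ∫⁻ x in Ω, ∫⁻ y in Ω, spreadDensity s p (2 / l) Ω u x y) := by
        rw [lintegral_const_mul' _ _ ENNReal.ofReal_ne_top,
          lintegral_add_right _ (hK.const_mul _),
          lintegral_const_mul' _ _ ENNReal.ofReal_ne_top, gagliardoSeminormPow]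
    _ ≤ _ := by
        gcongr
        exact lintegral_lintegral_spreadDensity_le (by positivity) hΩ hne hu

/-- On the compact support δ is positive, so the density is continuous there and hence bounded.
Finiteness is what permits the absorption. -/
lemma hardyIntegral_lt_top {n : ℕ} (s : ℝ) {p : ℝ} (hp : 0 < p)
    {Ω : Set (EuclideanSpace ℝ (Fin n))} (hΩ : IsOpen Ω) (hne : Ω ≠ Set.univ)
    {u : EuclideanSpace ℝ (Fin n) → ℝ} (hu : Continuous u) (hc : HasCompactSupport u)
    (hsupp : tsupport u ⊆ Ω) : hardyIntegral s p Ω u < ⊤ := by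
  have hcont : ContinuousOn (hardyDensity s p Ω u) (tsupport u) := by
    refine ContinuousOn.div ?_ ?_ fun x hx =>
      (Real.rpow_pos_of_pos (infDist_compl_pos hΩ hne (hsupp hx)) _).ne'
    · exact (hu.abs.rpow_const fun _ => Or.inr hp.le).continuousOn
    · exact (continuous_infDist_pt _).continuousOn.rpow_const fun x hx =>
        Or.inl (infDist_compl_pos hΩ hne (hsupp hx)).ne'
  obtain ⟨M, hM⟩ := hc.isCompact.exists_bound_of_continuousOn hcont
  calc hardyIntegral s p Ω u
      ≤ ∫⁻ x, ENNReal.ofReal (hardyDensity s p Ω u x) := setLIntegral_le_lintegral _ _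
    _ ≤ ∫⁻ x, (tsupport u).indicator (fun _ => ENNReal.ofReal M) x := by
        refine lintegral_mono fun x => ?_
        by_cases hx : x ∈ tsupport u
        · rw [Set.indicator_of_mem hx]
          exact ENNReal.ofReal_le_ofReal ((le_abs_self _).trans (hM x hx))
        · simp [hardyDensity, image_eq_zero_of_notMem_tsupport hx, Real.zero_rpow hp.ne']
    _ = ENNReal.ofReal M * volume (tsupport u) :=
        lintegral_indicator_const (isClosed_tsupport u).measurableSet _
    _ < ⊤ := ENNReal.mul_lt_top ENNReal.ofReal_lt_top hc.isCompact.measure_lt_top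

/-- For `s * p > n` the factor produced by one step towards the boundary is small. -/
lemma exists_scale_small {n : ℕ} {q : ℝ} (hq : (n : ℝ) < q) (p : ℝ) :
    ∃ l : ℝ, 0 < l ∧ l ≤ 1 ∧
      2 ^ (p - 1) * ((3 / 2 * l) ^ (n + q) * (2 / l) ^ n) ≤ (l / 2) ^ n / 2 := by
  -- Dividing the left side by (l/2)^n leaves exactly K * l^(q - n).
  set K : ℝ := 2 ^ (p - 1) * ((3 / 2) ^ (n + q) * 4 ^ n)
  have hlim : Filter.Tendsto (fun l : ℝ => K * l ^ (q - n)) (nhdsWithin 0 (Set.Ioi 0))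
      (nhds 0) := by
    have h : ContinuousAt (fun l : ℝ => K * l ^ (q - n)) 0 :=
      (Real.continuousAt_rpow_const _ _ (Or.inr (by linarith))).const_mul K
    have h' := h.tendsto.mono_left (nhdsWithin_le_nhds (s := Set.Ioi (0 : ℝ)))
    simpa [Real.zero_rpow (sub_pos.2 hq).ne'] using h'
  have h1 : ∀ᶠ l : ℝ in nhdsWithin 0 (Set.Ioi 0), l ≤ 1 :=
    nhdsWithin_le_nhds (eventually_le_nhds one_pos)
  obtain ⟨l, ⟨hl, hl1⟩, hl0⟩ :=
    (((hlim.eventually (eventually_le_nhds (by norm_num : (0 : ℝ) < 1 / 2))).and h1).and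
      self_mem_nhdsWithin).exists
  have hl0 : 0 < l := hl0
  refine ⟨l, hl0, hl1, ?_⟩
  have hsplit : l ^ (n + q) = l ^ (q - n) * (l ^ n * l ^ n) := by
    rw [← Real.rpow_natCast l n, ← Real.rpow_add hl0, ← Real.rpow_add hl0]
    congr 1
    ring
  have h4 : (4 : ℝ) ^ n = 2 ^ n * 2 ^ n := by rw [← mul_pow]; norm_num
  calc 2 ^ (p - 1) * ((3 / 2 * l) ^ (n + q) * (2 / l) ^ n)
      = K * l ^ (q - n) * (l / 2) ^ n := by
        rw [Real.mul_rpow (by norm_num) hl0.le, hsplit, div_pow, div_pow]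
        simp only [K, h4]
        field_simp
    _ ≤ 1 / 2 * (l / 2) ^ n := by gcongr
    _ = _ := by ring

/-- The regional fractional Hardy inequality for `s * p > n` on an arbitrary proper open set. -/
theorem exists_hardyIntegral_le_gagliardoSeminormPow {n : ℕ}
    {Ω : Set (EuclideanSpace ℝ (Fin n))} (hΩ : IsOpen Ω) (hne : Ω ≠ Set.univ) {s p : ℝ}
    (hs : 0 < s) (hp : 1 < p) (hsp : (n : ℝ) < s * p) :
    ∃ C : ℝ, 0 < C ∧ ∀ u : EuclideanSpace ℝ (Fin n) → ℝ, IsTestFunctionOn Ω u →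
      hardyIntegral s p Ω u ≤ ENNReal.ofReal C * gagliardoSeminormPow s p Ω u := by
  obtain ⟨l, hl0, hl1, hl⟩ := exists_scale_small hsp p
  set V := volume (ball (0 : EuclideanSpace ℝ (Fin n)) 1)
  have hV0 : 0 < V.toReal :=
    ENNReal.toReal_pos (measure_ball_pos volume _ one_pos).ne' measure_ball_lt_top.ne
  have hV : ENNReal.ofReal V.toReal = V := ENNReal.ofReal_toReal measure_ball_lt_top.ne
  set a : ℝ := (l / 2) ^ n * V.toReal with ha
  have ha0 : 0 < a := by positivity
  -- Absorption leaves (a/2) H ≤ 2^(p-1) G.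
  refine ⟨2 * 2 ^ (p - 1) / a, by positivity, fun u hu => ?_⟩
  obtain ⟨hsmooth, hc, hsupp⟩ := hu
  have hH := hardyIntegral_lt_top s (one_pos.trans hp) hΩ hne hsmooth.continuous hc hsupp
  have key := hardyIntegral_le_gagliardo_add hs hp hΩ hne hsmooth.continuous.measurable hl0 hl1
  rcases eq_or_ne (gagliardoSeminormPow s p Ω u) ⊤ with hG | hG
  · rw [hG, ENNReal.mul_top (by simpa using (by positivity))]
    exact le_top
  obtain ⟨H, hH0, hHe⟩ : ∃ H : ℝ, 0 ≤ H ∧ hardyIntegral s p Ω u = ENNReal.ofReal H :=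
    ⟨_, ENNReal.toReal_nonneg, (ENNReal.ofReal_toReal hH.ne).symm⟩
  obtain ⟨G, hG0, hGe⟩ : ∃ G : ℝ, 0 ≤ G ∧ gagliardoSeminormPow s p Ω u = ENNReal.ofReal G :=
    ⟨_, ENNReal.toReal_nonneg, (ENNReal.ofReal_toReal hG).symm⟩
  change _ * V * _ ≤ _ * (_ + _ * (_ * V * _)) at key
  rw [hHe, hGe, ← hV, ← ENNReal.ofReal_mul (by positivity), ← ENNReal.ofReal_mul (by positivity),
    ← ENNReal.ofReal_mul (by positivity), ← ENNReal.ofReal_mul (by positivity),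
    ← ENNReal.ofReal_mul (by positivity), ← ENNReal.ofReal_add hG0 (by positivity),
    ← ENNReal.ofReal_mul (by positivity), ENNReal.ofReal_le_ofReal_iff (by positivity)] at key
  rw [hHe, hGe, ← ENNReal.ofReal_mul (by positivity)]
  refine ENNReal.ofReal_le_ofReal ?_
  have hmul := mul_le_mul_of_nonneg_right hl (mul_nonneg hV0.le hH0)
  have : a * H ≤ 2 * 2 ^ (p - 1) * G := by
    rw [ha]
    linarith
  rw [div_mul_eq_mul_div, le_div_iff₀ ha0]
  linarith

lemma gagliardoSeminormPow_mono {n : ℕ} (s p : ℝ) {Ω Ω' : Set (EuclideanSpace ℝ (Fin n))}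
    (h : Ω ⊆ Ω') (u : EuclideanSpace ℝ (Fin n) → ℝ) :
    gagliardoSeminormPow s p Ω u ≤ gagliardoSeminormPow s p Ω' u :=
  (lintegral_mono fun _ => lintegral_mono_set h).trans (lintegral_mono_set h)

theorem theorem1p3 (n : ℕ) (Ω : Set (EuclideanSpace ℝ (Fin n))) (hΩ : IsOpen Ω)
    (hΩ_ne : Ω ≠ Set.univ) (s p : ℝ) (hs0 : 0 < s) (hs1 : s < 1) (hp : 1 < p)
    (hsp : (n : ℝ) < s * p) :
    (∃ C : ℝ, 0 < C ∧ ∀ u : EuclideanSpace ℝ (Fin n) → ℝ, IsTestFunctionOn Ω u →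
      hardyIntegral s p Ω u ≤ ENNReal.ofReal C * gagliardoSeminormPow s p Set.univ u) ∧
    (∃ C : ℝ, 0 < C ∧ ∀ u : EuclideanSpace ℝ (Fin n) → ℝ, IsTestFunctionOn Ω u →
      hardyIntegral s p Ω u ≤ ENNReal.ofReal C * gagliardoSeminormPow s p Ω u) := by
  obtain ⟨C, hC, h⟩ := exists_hardyIntegral_le_gagliardoSeminormPow hΩ hΩ_ne hs0 hp hsp
  refine ⟨⟨C, hC, fun u hu => (h u hu).trans ?_⟩, C, hC, h⟩
  -- Enlarging the domain only increases the energy, so the regional constant also serves on the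
  -- whole space.
  gcongr
  exact gagliardoSeminormPow_mono s p (Set.subset_univ Ω) u
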